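/- Let $w=(w_n)_{n\ge 1}$ be a non-increasing sequence of positive real numbers with $w_n\to 0$ and $\sum_n w_n=\infty$. Let $d(w,1)$ be the Lorentz sequence space of all real sequences $x=(x_n)$ with $$\|x\|=\sup_{\pi}\sum_{n=1}^\infty w_n|x_{\pi(n)}|<\infty,$$ where $\pi$ runs over all permutations of $\mathbb N$, and let $d(w,1)_*$ be its canonical predual, i.e. the norm-closed linear span in $d(w,1)^*$ of the coordinate functionals $x\mapsto x_n$, $n\in\mathbb N$, with the norm of $d(w,1)^*$. Then there is an equivalent norm $|\cdot|$ on $d(w,1)_*$ such that the Banach space $Z=(d(w,1)_*,|\cdot|)$ has the following three properties. 1. $Z$ is strictly convex. 2. $Z$ has a $1$-unconditional basis: there are $e_n\in Z$ and $e_n^*\in Z^*$ $(n\in\mathbb N)$ with $e_m^*(e_n)=\delta_{mn}$ such that for every $z\in Z$ the series $\sum_n e_n^*(z)e_n$ converges unconditionally to $z$; and for every finite $F\subset\mathbb N$ and all real $(a_n)_{n\in F}$, $(b_n)_{n\in F}$ with $|b_n|\le|a_n|$ for $n\in F$, $$\Big|\sum_{n\in F}b_ne_n\Big|\le\Big|\sum_{n\in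 F}a_ne_n\Big|.$$ 3. $Z$ has the local diameter two property (LD2P): for every $f\in Z^*$ of norm one and every $\varepsilon>0$, the slice $\{z\in Z: |z|\le 1,\ f(z)>1-\varepsilon\}$ has diameter $2$ in the norm $|\cdot|$. -/

import Mathlib

open scoped ENNReal

noncomputable section

/-! ### Lorentz sequence spaces `d(w,1)` -/

/-- A Lorentz weight: a non-increasing sequence of positive reals tending to `0` whose series
diverges. -/
structure LorentzWeight where
  /-- the terms of the weight -/
  seq : ℕ → ℝ
  pos : ∀ n, 0 < seq n
  anti : Antitone seq
  tendsto_zero : Filter.Tendsto seq Filter.atTop (nhds 0)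
  not_summable : ¬ Summable seq

/-- The Lorentz functional `sup_π ∑ₙ wₙ |x_{π(n)}|`, with `π` running over all permutations
of the index set, as an extended non-negative real. -/
def lorentzENorm (w : LorentzWeight) (x : ℕ → ℝ) : ℝ≥0∞ :=
  ⨆ π : Equiv.Perm ℕ, ∑' n, ENNReal.ofReal (w.seq n * |x (π n)|)

theorem lorentzENorm_zero (w : LorentzWeight) : lorentzENorm w 0 = 0 := by
  simp [lorentzENorm]

theorem lorentzENorm_add_le (w : LorentzWeight) (x y : ℕ → ℝ) :
    lorentzENorm w (x + y) ≤ lorentzENorm w x + lorentzENorm w y := by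
  refine iSup_le fun π => ?_
  have h1 : ∑' n, ENNReal.ofReal (w.seq n * |(x + y) (π n)|) ≤
      ∑' n, (ENNReal.ofReal (w.seq n * |x (π n)|) + ENNReal.ofReal (w.seq n * |y (π n)|)) := by
    refine ENNReal.tsum_le_tsum fun n => ?_
    rw [← ENNReal.ofReal_add (mul_nonneg (w.pos n).le (abs_nonneg _))
      (mul_nonneg (w.pos n).le (abs_nonneg _)), ← mul_add]
    exact ENNReal.ofReal_le_ofReal
      (mul_le_mul_of_nonneg_left (abs_add_le _ _) (w.pos n).le)
  rw [ENNReal.tsum_add] at h1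
  exact h1.trans (add_le_add
    (le_iSup (fun σ : Equiv.Perm ℕ => ∑' n, ENNReal.ofReal (w.seq n * |x (σ n)|)) π)
    (le_iSup (fun σ : Equiv.Perm ℕ => ∑' n, ENNReal.ofReal (w.seq n * |y (σ n)|)) π))

theorem lorentzENorm_smul (w : LorentzWeight) (c : ℝ) (x : ℕ → ℝ) :
    lorentzENorm w (c • x) = ENNReal.ofReal |c| * lorentzENorm w x := by
  unfold lorentzENorm
  rw [ENNReal.mul_iSup]
  refine iSup_congr fun π => ?_
  rw [← ENNReal.tsum_mul_left]
  refine tsum_congr fun n => ?_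
  rw [← ENNReal.ofReal_mul (abs_nonneg c)]
  congr 1
  simp only [Pi.smul_apply, smul_eq_mul, abs_mul]
  ring

theorem le_lorentzENorm (w : LorentzWeight) (x : ℕ → ℝ) (n : ℕ) :
    ENNReal.ofReal (w.seq 0 * |x n|) ≤ lorentzENorm w x := by
  refine le_trans ?_ (le_iSup (fun σ : Equiv.Perm ℕ =>
    ∑' k, ENNReal.ofReal (w.seq k * |x (σ k)|)) (Equiv.swap 0 n))
  refine le_trans (le_of_eq ?_) (ENNReal.le_tsum 0)
  simp

/-- The vector space of real sequences with finite Lorentz functional. -/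
def lorentzSubmodule (w : LorentzWeight) : Submodule ℝ (ℕ → ℝ) where
  carrier := {x | lorentzENorm w x ≠ ∞}
  zero_mem' := by simp [lorentzENorm_zero]
  add_mem' {x y} hx hy :=
    ne_top_of_le_ne_top (ENNReal.add_ne_top.2 ⟨hx, hy⟩) (lorentzENorm_add_le w x y)
  smul_mem' c x hx := by
    simp only [Set.mem_ofPred_eq, lorentzENorm_smul]
    exact ENNReal.mul_ne_top ENNReal.ofReal_ne_top hx

/-- The real Lorentz sequence space `d(w,1)`. -/
def LorentzSpace (w : LorentzWeight) : Type := lorentzSubmodule w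

namespace LorentzSpace

variable {w : LorentzWeight}

instance : AddCommGroup (LorentzSpace w) := inferInstanceAs (AddCommGroup (lorentzSubmodule w))

instance : Module ℝ (LorentzSpace w) := inferInstanceAs (Module ℝ (lorentzSubmodule w))

/-- The inclusion of `d(w,1)` into the space of all real sequences. -/
def toSeq (w : LorentzWeight) : LorentzSpace w →ₗ[ℝ] (ℕ → ℝ) := (lorentzSubmodule w).subtype

theorem toSeq_ne_top (x : LorentzSpace w) : lorentzENorm w (toSeq w x) ≠ ∞ := x.2

theorem toSeq_injective : Function.Injective (toSeq w) := Subtype.val_injective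

/-- The norm `‖x‖ = sup_π ∑ₙ wₙ |x_{π(n)}|` of `d(w,1)`. -/
instance : Norm (LorentzSpace w) := ⟨fun x => (lorentzENorm w (toSeq w x)).toReal⟩

theorem norm_def (x : LorentzSpace w) : ‖x‖ = (lorentzENorm w (toSeq w x)).toReal := rfl

theorem mul_abs_le_norm (x : LorentzSpace w) (n : ℕ) : w.seq 0 * |toSeq w x n| ≤ ‖x‖ :=
  (ENNReal.ofReal_le_iff_le_toReal (toSeq_ne_top x)).1 (le_lorentzENorm w _ n)

theorem core (w : LorentzWeight) : NormedSpace.Core ℝ (LorentzSpace w) where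
  norm_nonneg x := ENNReal.toReal_nonneg
  norm_smul c x := by
    rw [norm_def, norm_def, map_smul, lorentzENorm_smul, ENNReal.toReal_mul,
      ENNReal.toReal_ofReal (abs_nonneg c), Real.norm_eq_abs]
  norm_triangle x y := by
    rw [norm_def, norm_def, norm_def, map_add,
      ← ENNReal.toReal_add (toSeq_ne_top x) (toSeq_ne_top y)]
    exact ENNReal.toReal_mono (ENNReal.add_ne_top.2 ⟨toSeq_ne_top x, toSeq_ne_top y⟩)
      (lorentzENorm_add_le w _ _)
  norm_eq_zero_iff x := by
    constructor
    · intro h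
      apply toSeq_injective
      rw [map_zero]
      funext n
      have h1 := mul_abs_le_norm x n
      rw [h] at h1
      have h2 : |toSeq w x n| ≤ 0 := by
        by_contra hc
        exact absurd h1 (not_le.2 (mul_pos (w.pos 0) (not_le.1 hc)))
      exact abs_nonpos_iff.1 h2
    · rintro rfl
      rw [norm_def, map_zero, lorentzENorm_zero, ENNReal.toReal_zero]

instance : NormedAddCommGroup (LorentzSpace w) := NormedAddCommGroup.ofCore (core w)

instance : NormedSpace ℝ (LorentzSpace w) := NormedSpace.ofCore (core w)

/-- The `n`-th coordinate functional `x ↦ xₙ` on `d(w,1)`. -/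
def coord (w : LorentzWeight) (n : ℕ) : StrongDual ℝ (LorentzSpace w) :=
  LinearMap.mkContinuous ((LinearMap.proj n).comp (toSeq w)) (w.seq 0)⁻¹ fun x => by
    rw [inv_mul_eq_div, le_div_iff₀ (w.pos 0), mul_comm]
    exact mul_abs_le_norm x n

@[simp]
theorem coord_apply (n : ℕ) (x : LorentzSpace w) : coord w n x = toSeq w x n := rfl

end LorentzSpace

/-- The canonical predual `d(w,1)_*` of `d(w,1)`: the norm-closed linear span, in the dual
of `d(w,1)`, of the functionals biorthogonal to the unit vector basis of `d(w,1)`. It carries the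
norm of the dual of `d(w,1)`. -/
def lorentzPredual (w : LorentzWeight) : Submodule ℝ (StrongDual ℝ (LorentzSpace w)) :=
  (Submodule.span ℝ (Set.range (LorentzSpace.coord w))).topologicalClosure

/-! ### Equivalent renormings -/

/-- An equivalent norm on a real normed space `E`. -/
structure EquivalentNorm (E : Type*) [NormedAddCommGroup E] [NormedSpace ℝ E] extends
    Seminorm ℝ E where
  norm_le_mul : ∃ C : ℝ, ∀ x : E, ‖x‖ ≤ C * toFun x
  le_mul_norm : ∃ C : ℝ, ∀ x : E, toFun x ≤ C * ‖x‖

namespace EquivalentNorm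

universe u

variable {E : Type u} [NormedAddCommGroup E] [NormedSpace ℝ E]

/-- The vector space `E` endowed with the equivalent norm `N` in place of its original norm. -/
@[nolint unusedArguments]
def Space (_N : EquivalentNorm E) : Type u := E

variable {N : EquivalentNorm E}

instance : AddCommGroup N.Space := inferInstanceAs (AddCommGroup E)

instance : Module ℝ N.Space := inferInstanceAs (Module ℝ E)

/-- The identity map from `E` to its renorming. -/
def toSpace (N : EquivalentNorm E) : E ≃ₗ[ℝ] N.Space := LinearEquiv.refl ℝ E

instance : Norm N.Space := ⟨fun x => N.toSeminorm (N.toSpace.symm x)⟩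

theorem norm_toSpace (x : E) : ‖N.toSpace x‖ = N.toSeminorm x := rfl

theorem norm_def (x : N.Space) : ‖x‖ = N.toSeminorm (N.toSpace.symm x) := rfl

theorem core (N : EquivalentNorm E) : NormedSpace.Core ℝ N.Space where
  norm_nonneg x := apply_nonneg N.toSeminorm _
  norm_smul c x := by
    rw [norm_def, norm_def, map_smul]
    exact map_smul_eq_mul N.toSeminorm c _
  norm_triangle x y := by
    rw [norm_def, norm_def, norm_def, map_add]
    exact map_add_le_add N.toSeminorm _ _
  norm_eq_zero_iff x := by
    constructor
    · intro h
      obtain ⟨C, hC⟩ := N.norm_le_mul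
      have h1 : ‖N.toSpace.symm x‖ ≤ C * N.toSeminorm (N.toSpace.symm x) := hC _
      rw [norm_def] at h
      rw [h, mul_zero] at h1
      exact N.toSpace.symm.map_eq_zero_iff.1 (norm_le_zero_iff.1 h1)
    · rintro rfl
      rw [norm_def, map_zero, map_zero]

instance : NormedAddCommGroup N.Space := NormedAddCommGroup.ofCore N.core

instance : NormedSpace ℝ N.Space := NormedSpace.ofCore N.core

end EquivalentNorm

/-! ### Geometric properties -/

/-- The slice `S(f, ε) = {x ∈ B_X : f x > 1 - ε}` of the closed unit ball of `X`. -/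
def ballSlice {X : Type*} [NormedAddCommGroup X] [NormedSpace ℝ X] (f : StrongDual ℝ X)
    (ε : ℝ) : Set X :=
  {x | ‖x‖ ≤ 1 ∧ 1 - ε < f x}

/-- The local diameter two property: every slice of the unit ball given by a norm one functional
has diameter two. -/
def HasLD2P (X : Type*) [NormedAddCommGroup X] [NormedSpace ℝ X] : Prop :=
  ∀ f : StrongDual ℝ X, ‖f‖ = 1 → ∀ ε : ℝ, 0 < ε → Metric.diam (ballSlice f ε) = 2

/-- An unconditional basis is `1`-unconditional if shrinking the absolute values of finitely
supported coefficient families does not increase the norm. -/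
def IsOneUnconditional {ι X : Type*} [NormedAddCommGroup X] [NormedSpace ℝ X]
    (e : UnconditionalSchauderBasis ι ℝ X) : Prop :=
  ∀ (F : Finset ι) (a b : ι → ℝ), (∀ i ∈ F, |b i| ≤ |a i|) →
    ‖∑ i ∈ F, b i • e.basis i‖ ≤ ‖∑ i ∈ F, a i • e.basis i‖

end

open Filter Topology
open scoped NNReal

noncomputable section

/-! Write `W n = w₀ + ⋯ + wₙ₋₁`. The predual norm is `sup_n p n`, where `p n φ` is the largest value
of `(∑_{i ∈ A} |φᵢ|) / W (n + 1)` over sets `A` of size `n + 1` (`maxAvg_le_norm`,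
`norm_le_of_maxAvg_le`). Since `W n → ∞`, `p n φ → 0` for each `φ`, so the norm behaves like a `c₀`
norm. The new norm is `sup_n (p n + q / (n + 1))`, with `q` a weighted `ℓ²` norm.

Strict convexity: the levels tend to zero, so the supremum at `x + y ≠ 0` is attained at some `n`.
If `|x| = |y| = 1` and `|x + y| = 2`, that level forces `q (x + y) = q x + q y`, and `q` is strictly
convex.

LD2P: the indicators of `{0, …, n}` have norm at least `(n + 1) / W (n + 1) → ∞`, because `w → 0`,
while `q` and each fixed `p m` stay bounded on them. Normalised, they give `u` that is small on the
first levels, while a given `x` is small on the rest; hence `|x ± u| ≤ 1 + δ`.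

Unconditionality: `p n` and `q` are monotone in the moduli of the coefficients. -/

/-! ### A criterion for the local diameter two property -/

/-- A normed space in which every point of the closed unit ball admits almost norm-preserving
perturbations in both directions `± u` with `‖u‖ ≥ 1` has the local diameter two property. -/
theorem hasLD2P_of_locally_almost_square {X : Type*} [NormedAddCommGroup X] [NormedSpace ℝ X]
    (h : ∀ x : X, ‖x‖ ≤ 1 → ∀ δ : ℝ, 0 < δ →
      ∃ u : X, 1 ≤ ‖u‖ ∧ ‖x + u‖ ≤ 1 + δ ∧ ‖x - u‖ ≤ 1 + δ) : HasLD2P X := by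
  intro f hf ε hε
  have hsub : ballSlice f ε ⊆ Metric.closedBall 0 1 := fun x hx => by simpa using hx.1
  have hbdd : Bornology.IsBounded (ballSlice f ε) := Metric.isBounded_closedBall.subset hsub
  have hle (y : X) : f y ≤ ‖y‖ := by
    simpa [hf] using (le_abs_self _).trans (f.le_opNorm y)
  apply le_antisymm
  · exact (Metric.diam_mono hsub Metric.isBounded_closedBall).trans
      ((Metric.diam_closedBall zero_le_one).trans (by norm_num))
  obtain ⟨x, hx1, hx⟩ : ∃ x : X, ‖x‖ ≤ 1 ∧ 1 - ε / 3 < f x := by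
    obtain ⟨y, hy1, hy⟩ := f.exists_lt_apply_of_lt_opNorm (r := 1 - ε / 3) (by rw [hf]; linarith)
    rcases le_total 0 (f y) with h0 | h0
    · exact ⟨y, hy1.le, by rwa [Real.norm_of_nonneg h0] at hy⟩
    · exact ⟨-y, by simpa using hy1.le, by rwa [Real.norm_of_nonpos h0, ← map_neg] at hy⟩
  -- Since `f (x ± u) ≤ 1 + δ` and `f x > 1 - ε / 3`, both values exceed `1 - 2ε/3 - δ`. Dividing by
  -- `1 + δ` keeps them above `1 - ε` because `2δ < ε / 3`.
  have key : ∀ δ : ℝ, 0 < δ → δ < ε / 6 → 2 ≤ Metric.diam (ballSlice f ε) * (1 + δ) := by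
    intro δ hδ hδε
    obtain ⟨u, hu, hp, hm⟩ := h x hx1 δ hδ
    have hδ1 : (0 : ℝ) < 1 + δ := by linarith
    have h1 := (hle (x + u)).trans hp
    have h2 := (hle (x - u)).trans hm
    rw [map_add] at h1
    rw [map_sub] at h2
    have hmem : ∀ y : X, ‖y‖ ≤ 1 + δ → 1 - 2 * ε / 3 - δ ≤ f y →
        (1 + δ)⁻¹ • y ∈ ballSlice f ε := by
      intro y hy hfy
      refine ⟨?_, ?_⟩
      · rw [norm_smul, norm_inv, Real.norm_of_nonneg hδ1.le, inv_mul_eq_div, div_le_one hδ1]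
        exact hy
      · rw [map_smul, smul_eq_mul, inv_mul_eq_div, lt_div_iff₀ hδ1]
        nlinarith
    have hd := Metric.dist_le_diam_of_mem hbdd
      (hmem (x + u) hp (by rw [map_add]; linarith)) (hmem (x - u) hm (by rw [map_sub]; linarith))
    rw [dist_eq_norm, ← smul_sub, norm_smul, norm_inv, Real.norm_of_nonneg hδ1.le,
      inv_mul_eq_div, div_le_iff₀ hδ1] at hd
    have h3 : x + u - (x - u) = (2 : ℝ) • u := by rw [two_smul]; abel
    rw [h3, norm_smul, Real.norm_of_nonneg zero_le_two] at hd
    linarith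
  have hlim : Tendsto (fun δ : ℝ => Metric.diam (ballSlice f ε) * (1 + δ)) (𝓝[>] 0)
      (𝓝 (Metric.diam (ballSlice f ε) * (1 + 0))) :=
    (Continuous.tendsto (by fun_prop) 0).mono_left nhdsWithin_le_nhds
  rw [add_zero, mul_one] at hlim
  refine ge_of_tendsto hlim ?_
  filter_upwards [Ioo_mem_nhdsGT (show (0 : ℝ) < ε / 6 by linarith)] with δ hδ
  exact key δ hδ.1 hδ.2

/-! ### Renorming by a perturbed supremum -/

/-- A `c₀`-like presentation of the norm of `E` as a supremum of seminorms `p n` that vanish at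
infinity, together with a bounded strictly convex seminorm `q`. -/
structure SupPresentation (E : Type*) [NormedAddCommGroup E] [NormedSpace ℝ E] where
  /-- the seminorms whose supremum is the norm -/
  p : ℕ → Seminorm ℝ E
  /-- the strictly convex perturbation -/
  q : Seminorm ℝ E
  p_le : ∀ n x, p n x ≤ ‖x‖
  norm_le : ∀ x c, (∀ n, p n x ≤ c) → ‖x‖ ≤ c
  tendsto_p : ∀ x, Tendsto (fun n => p n x) atTop (𝓝 0)
  q_le : ∃ C, ∀ x, q x ≤ C * ‖x‖
  sameRay : ∀ x y, q (x + y) = q x + q y → SameRay ℝ x y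

namespace SupPresentation

variable {E : Type*} [NormedAddCommGroup E] [NormedSpace ℝ E] (P : SupPresentation E)

/-- The `n`-th perturbed seminorm `p n + q / (n + 1)`. -/
def level (n : ℕ) : Seminorm ℝ E := P.p n + ((n : ℝ≥0) + 1)⁻¹ • P.q

theorem level_apply (n : ℕ) (x : E) : P.level n x = P.p n x + ((n : ℝ) + 1)⁻¹ * P.q x := by
  rfl

theorem level_le (n : ℕ) (x : E) : P.level n x ≤ ‖x‖ + P.q x := by
  rw [level_apply]
  refine add_le_add (P.p_le n x) (mul_le_of_le_one_left (apply_nonneg _ _) ?_)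
  exact inv_le_one_of_one_le₀ (by linarith [n.cast_nonneg (α := ℝ)])

theorem bddAbove_level (x : E) : BddAbove (Set.range fun n => P.level n x) :=
  ⟨_, Set.forall_mem_range.2 fun n => P.level_le n x⟩

/-- The perturbed supremum. -/
def seminorm : Seminorm ℝ E := ⨆ n, P.level n

theorem seminorm_apply (x : E) : P.seminorm x = ⨆ n, P.level n x :=
  Seminorm.iSup_apply (Seminorm.bddAbove_range_iff.2 P.bddAbove_level)

theorem level_le_seminorm (n : ℕ) (x : E) : P.level n x ≤ P.seminorm x := by
  rw [seminorm_apply]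
  exact le_ciSup (P.bddAbove_level x) n

theorem seminorm_le {x : E} {c : ℝ} (h : ∀ n, P.level n x ≤ c) : P.seminorm x ≤ c := by
  rw [seminorm_apply]
  exact ciSup_le h

theorem p_le_level (n : ℕ) (x : E) : P.p n x ≤ P.level n x := by
  rw [level_apply]
  exact le_add_of_nonneg_right (mul_nonneg (by positivity) (apply_nonneg _ _))

theorem norm_le_seminorm (x : E) : ‖x‖ ≤ P.seminorm x :=
  P.norm_le x _ fun n => (P.p_le_level n x).trans (P.level_le_seminorm n x)

/-- The equivalent norm given by the perturbed supremum. -/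
def equivalentNorm : EquivalentNorm E where
  toSeminorm := P.seminorm
  norm_le_mul := ⟨1, fun x => (P.norm_le_seminorm x).trans (one_mul _).ge⟩
  le_mul_norm := by
    obtain ⟨C, hC⟩ := P.q_le
    refine ⟨1 + C, fun x => P.seminorm_le fun n => (P.level_le n x).trans ?_⟩
    rw [add_mul, one_mul]
    exact add_le_add_right (hC x) _

theorem tendsto_inv_mul (c : ℝ) : Tendsto (fun n : ℕ => ((n : ℝ) + 1)⁻¹ * c) atTop (𝓝 0) := by
  simpa using (tendsto_one_div_add_atTop_nhds_zero_nat (𝕜 := ℝ)).mul_const c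

theorem tendsto_level (x : E) : Tendsto (fun n => P.level n x) atTop (𝓝 0) := by
  simpa only [level_apply, add_zero] using (P.tendsto_p x).add (tendsto_inv_mul (P.q x))

/-- Only finitely many levels can exceed a given positive one, so the supremum is a maximum. -/
theorem exists_seminorm_eq_level (x : E) (hx : x ≠ 0) : ∃ n, P.seminorm x = P.level n x := by
  obtain ⟨n₀, hn₀⟩ : ∃ n, 0 < P.level n x := by
    by_contra! h
    exact absurd ((P.norm_le_seminorm x).trans (P.seminorm_le h)) (not_le.2 (norm_pos_iff.2 hx))
  obtain ⟨n, hn⟩ := (continuous_of_discreteTopology (f := fun n => P.level n x)).exists_forall_ge'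
    n₀ (by
      rw [cocompact_eq_cofinite, Nat.cofinite_eq_atTop]
      exact ((P.tendsto_level x).eventually_lt_const hn₀).mono fun _ h => h.le)
  exact ⟨n, le_antisymm (P.seminorm_le hn) (P.level_le_seminorm n x)⟩

theorem strictConvexSpace : StrictConvexSpace ℝ P.equivalentNorm.Space := by
  refine StrictConvexSpace.of_norm_add fun x y hx hy hxy => ?_
  change P.seminorm (show E from x) = 1 at hx
  change P.seminorm (show E from y) = 1 at hy
  change P.seminorm ((show E from x) + (show E from y)) = 2 at hxy
  change SameRay ℝ (show E from x) (show E from y)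
  generalize (show E from x) = x at *
  generalize (show E from y) = y at *
  have hne : x + y ≠ 0 := by
    intro h
    rw [h, map_zero] at hxy
    norm_num at hxy
  obtain ⟨n, hn⟩ := P.exists_seminorm_eq_level _ hne
  apply P.sameRay
  have h1 := P.level_le_seminorm n x
  have h2 := P.level_le_seminorm n y
  have hp := map_add_le_add (P.p n) x y
  have hq := map_add_le_add P.q x y
  rw [hxy, level_apply] at hn
  rw [hx, level_apply] at h1
  rw [hy, level_apply] at h2
  have hpos : (0 : ℝ) < ((n : ℝ) + 1)⁻¹ := by positivity
  refine le_antisymm hq (le_of_mul_le_mul_left ?_ hpos)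
  rw [mul_add]
  linarith

theorem exists_almost_square {v : ℕ → E} (hv : Tendsto (fun n => ‖v n‖) atTop atTop)
    (hp : ∀ m, ∃ K, ∀ n, P.p m (v n) ≤ K) (hq : ∃ K, ∀ n, P.q (v n) ≤ K)
    (x : E) (hx : P.seminorm x ≤ 1) {δ : ℝ} (hδ : 0 < δ) :
    ∃ u : E, 1 ≤ P.seminorm u ∧ P.seminorm (x + u) ≤ 1 + δ ∧ P.seminorm (x - u) ≤ 1 + δ := by
  have hsmall (s : Seminorm ℝ E) (hs : ∃ K, ∀ n, s (v n) ≤ K) :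
      ∀ᶠ n in atTop, s (‖v n‖⁻¹ • v n) ≤ δ / 2 := by
    obtain ⟨K, hK⟩ := hs
    have h1 : Tendsto (fun n => ‖v n‖⁻¹ * K) atTop (𝓝 0) := by
      simpa using hv.inv_tendsto_atTop.mul_const K
    filter_upwards [h1.eventually_lt_const (half_pos hδ)] with n hn
    rw [map_smul_eq_mul, norm_inv, norm_norm]
    exact (mul_le_mul_of_nonneg_left (hK n) (by positivity)).trans hn.le
  obtain ⟨m₀, hm₀⟩ := eventually_atTop.1
    ((P.tendsto_level x).eventually_lt_const (half_pos hδ))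
  obtain ⟨n, hn0, hnq, hnp⟩ := ((hv.eventually_gt_atTop 0).and ((hsmall P.q hq).and
    ((Finset.eventually_all (Finset.range m₀)).2 fun m _ => hsmall (P.p m) (hp m)))).exists
  set u := ‖v n‖⁻¹ • v n
  have hu : ‖u‖ = 1 := by
    rw [norm_smul, norm_inv, norm_norm, inv_mul_cancel₀ hn0.ne']
  -- Below `m₀` both parts of the level of `u` are at most `δ / 2`; from `m₀` on, the level of `x`
  -- is below `δ / 2` and `p m u ≤ 1`.
  have key (m : ℕ) : P.level m x + P.level m u ≤ 1 + δ := by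
    have hqm : ((m : ℝ) + 1)⁻¹ * P.q u ≤ δ / 2 := by
      refine (mul_le_of_le_one_left (apply_nonneg _ _) ?_).trans hnq
      exact inv_le_one_of_one_le₀ (by linarith [m.cast_nonneg (α := ℝ)])
    have h1 := (P.level_le_seminorm m x).trans hx
    have h2 := P.p_le m u
    rw [P.level_apply m u]
    rcases lt_or_ge m m₀ with hm | hm
    · linarith [hnp m (Finset.mem_range.2 hm)]
    · linarith [hm₀ m hm]
  refine ⟨u, hu.ge.trans (P.norm_le_seminorm u), ?_, ?_⟩
  · exact P.seminorm_le fun m => (map_add_le_add _ _ _).trans (key m)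
  · exact P.seminorm_le fun m => (map_sub_le_add _ _ _).trans (key m)

theorem hasLD2P {v : ℕ → E} (hv : Tendsto (fun n => ‖v n‖) atTop atTop)
    (hp : ∀ m, ∃ K, ∀ n, P.p m (v n) ≤ K) (hq : ∃ K, ∀ n, P.q (v n) ≤ K) :
    HasLD2P P.equivalentNorm.Space :=
  hasLD2P_of_locally_almost_square fun x hx _ hδ => P.exists_almost_square hv hp hq x hx hδ

theorem seminorm_mono {x y : E} (hp : ∀ n, P.p n x ≤ P.p n y) (hq : P.q x ≤ P.q y) :
    P.seminorm x ≤ P.seminorm y := by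
  refine P.seminorm_le fun n => le_trans ?_ (P.level_le_seminorm n y)
  rw [level_apply, level_apply]
  exact add_le_add (hp n) (mul_le_mul_of_nonneg_left hq (by positivity))

end SupPresentation

/-! ### Rearrangements and Abel summation -/

/-- Sorting a finite initial block and fixing the rest gives a permutation of all of `ℕ`, as the
supremum defining the Lorentz norm requires. -/
theorem exists_perm_antitone_abs (x : ℕ → ℝ) (N : ℕ) :
    ∃ τ : Equiv.Perm ℕ, (Finset.range N).map τ.toEmbedding = Finset.range N ∧
      ∀ k, k + 1 < N → |x (τ (k + 1))| ≤ |x (τ k)| := by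
  set f : Fin N → ℝ := fun i => -|x i|
  set τ := (Tuple.sort f).viaFintypeEmbedding Fin.valEmbedding
  have hτ (k : ℕ) (hk : k < N) : τ k = Tuple.sort f ⟨k, hk⟩ :=
    Equiv.Perm.viaFintypeEmbedding_apply_image (Tuple.sort f) Fin.valEmbedding ⟨k, hk⟩
  refine ⟨τ, ?_, fun k hk => ?_⟩
  · refine Finset.eq_of_subset_of_card_le (fun i hi => ?_) (by simp)
    obtain ⟨k, hk, rfl⟩ := Finset.mem_map.1 hi
    rw [Equiv.toEmbedding_apply, hτ k (Finset.mem_range.1 hk)]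
    exact Finset.mem_range.2 (Fin.is_lt _)
  · rw [hτ _ hk, hτ k (by omega)]
    have h := Tuple.monotone_sort f (show (⟨k, by omega⟩ : Fin N) ≤ ⟨k + 1, hk⟩ by simp)
    simpa [f] using h

/-- Summation by parts: the partial sums of `v - u` are nonnegative and get multiplied by the
nonnegative decrements of `b` and by its last term. -/
theorem sum_mul_le_sum_mul_of_antitone {u v b : ℕ → ℝ} {N : ℕ} (hb : ∀ k, 0 ≤ b k)
    (hanti : ∀ k, k + 1 < N → b (k + 1) ≤ b k)
    (huv : ∀ n, ∑ k ∈ Finset.range n, u k ≤ ∑ k ∈ Finset.range n, v k) :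
    ∑ k ∈ Finset.range N, u k * b k ≤ ∑ k ∈ Finset.range N, v k * b k := by
  rcases N with _ | N
  · simp
  have key : ∀ n ≤ N, (∑ k ∈ Finset.range (n + 1), (v k - u k)) * b n ≤
      ∑ k ∈ Finset.range (n + 1), (v k - u k) * b k := by
    intro n
    induction n with
    | zero => simp
    | succ n ih =>
      intro hn
      rw [Finset.sum_range_succ, Finset.sum_range_succ (fun k => (v k - u k) * b k), add_mul]
      refine add_le_add (le_trans ?_ (ih (by omega))) le_rfl
      refine mul_le_mul_of_nonneg_left (hanti n (by omega)) ?_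
      rw [Finset.sum_sub_distrib]
      exact sub_nonneg.2 (huv _)
  have h := key N le_rfl
  have h0 : 0 ≤ (∑ k ∈ Finset.range (N + 1), (v k - u k)) * b N := by
    rw [Finset.sum_sub_distrib]
    exact mul_nonneg (sub_nonneg.2 (huv _)) (hb N)
  simp only [sub_mul, Finset.sum_sub_distrib] at h h0
  linarith

/-! ### Partial sums of a Lorentz weight -/

namespace LorentzWeight

variable (w : LorentzWeight)

/-- The partial sums `w₀ + ⋯ + wₙ₋₁`. -/
def partialSum (n : ℕ) : ℝ := ∑ k ∈ Finset.range n, w.seq k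

theorem partialSum_nonneg (n : ℕ) : 0 ≤ w.partialSum n :=
  Finset.sum_nonneg fun k _ => (w.pos k).le

theorem partialSum_succ_pos (n : ℕ) : 0 < w.partialSum (n + 1) :=
  Finset.sum_pos (fun k _ => w.pos k) (by simp)

theorem tendsto_partialSum : Tendsto w.partialSum atTop atTop :=
  (not_summable_iff_tendsto_nat_atTop_of_nonneg fun n => (w.pos n).le).1 w.not_summable

/-- The Cesàro means of `w` are positive and tend to zero with `w`; these are their inverses. -/
theorem tendsto_div_partialSum :
    Tendsto (fun n : ℕ => ((n : ℝ) + 1) / w.partialSum (n + 1)) atTop atTop := by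
  have h1 : Tendsto (fun n : ℕ => ((n + 1 : ℕ) : ℝ)⁻¹ * w.partialSum (n + 1)) atTop (𝓝[>] 0) := by
    refine tendsto_nhdsWithin_iff.2 ⟨?_, Eventually.of_forall fun n => ?_⟩
    · exact (w.tendsto_zero.cesaro).comp (tendsto_add_atTop_nat 1)
    · exact mul_pos (by positivity) (w.partialSum_succ_pos n)
  refine h1.inv_tendsto_nhdsGT_zero.congr fun n => ?_
  simp [div_eq_mul_inv, mul_comm]

theorem sum_le_partialSum (B : Finset ℕ) : ∑ k ∈ B, w.seq k ≤ w.partialSum B.card := by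
  induction B using Finset.induction_on_max with
  | empty => simp [partialSum]
  | insert a s hs ih =>
    have ha : a ∉ s := fun h => lt_irrefl _ (hs a h)
    rw [Finset.sum_insert ha, Finset.card_insert_of_notMem ha, partialSum,
      Finset.sum_range_succ, add_comm]
    -- The maximum `a` of the set is at least the number of smaller elements.
    refine add_le_add ih (w.anti ?_)
    have : s ⊆ Finset.range a := fun i hi => Finset.mem_range.2 (hs i hi)
    simpa using Finset.card_le_card this

end LorentzWeight

/-! ### Finitely supported vectors of the Lorentz space -/

theorem lorentzENorm_le_partialSum (w : LorentzWeight) {A : Finset ℕ} {x : ℕ → ℝ}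
    (h1 : ∀ i, |x i| ≤ 1) (h0 : ∀ i ∉ A, x i = 0) :
    lorentzENorm w x ≤ ENNReal.ofReal (w.partialSum A.card) := by
  refine iSup_le fun π => ?_
  have hs : ∀ k ∉ A.map π.symm.toEmbedding, ENNReal.ofReal (w.seq k * |x (π k)|) = 0 := by
    intro k hk
    rw [h0 (π k) fun h => hk (Finset.mem_map.2 ⟨π k, h, by simp⟩)]
    simp
  rw [tsum_eq_sum hs, ← ENNReal.ofReal_sum_of_nonneg fun k _ =>
    mul_nonneg (w.pos k).le (abs_nonneg _)]
  refine ENNReal.ofReal_le_ofReal (le_trans (Finset.sum_le_sum fun k _ =>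
    mul_le_of_le_one_right (w.pos k).le (h1 _)) ?_)
  simpa using w.sum_le_partialSum (A.map π.symm.toEmbedding)

namespace LorentzSpace

variable {w : LorentzWeight}

/-- The element of `d(w,1)` with the given finitely supported bounded coordinates. -/
def ofFinite (w : LorentzWeight) (A : Finset ℕ) (x : ℕ → ℝ) (h1 : ∀ i, |x i| ≤ 1)
    (h0 : ∀ i ∉ A, x i = 0) : LorentzSpace w :=
  (⟨x, ne_top_of_le_ne_top ENNReal.ofReal_ne_top (lorentzENorm_le_partialSum w h1 h0)⟩ :
    lorentzSubmodule w)

theorem norm_le_partialSum {A : Finset ℕ} {x : LorentzSpace w}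
    (h1 : ∀ i, |toSeq w x i| ≤ 1) (h0 : ∀ i ∉ A, toSeq w x i = 0) :
    ‖x‖ ≤ w.partialSum A.card :=
  ENNReal.toReal_le_of_le_ofReal (w.partialSum_nonneg _) (lorentzENorm_le_partialSum w h1 h0)

/-- The unit vectors of `d(w,1)`. -/
def unit (w : LorentzWeight) (i : ℕ) : LorentzSpace w :=
  ofFinite w {i} (Pi.single i 1)
    (fun j => by rcases eq_or_ne j i with rfl | h <;> simp [*])
    (fun j hj => by simp_all)

theorem toSeq_unit (i : ℕ) : toSeq w (unit w i) = Pi.single i 1 := rfl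

theorem coord_unit (i j : ℕ) : coord w i (unit w j) = (Pi.single j (1 : ℝ) : ℕ → ℝ) i := rfl

/-- Test `φ` on the sign vector supported on `A`, whose norm is at most `W |A|`. -/
theorem sum_abs_apply_unit_le (φ : StrongDual ℝ (LorentzSpace w)) (A : Finset ℕ) :
    ∑ i ∈ A, |φ (unit w i)| ≤ w.partialSum A.card * ‖φ‖ := by
  set x : LorentzSpace w := ∑ i ∈ A, (SignType.sign (φ (unit w i)) : ℝ) • unit w i
  have hx (j : ℕ) : toSeq w x j = if j ∈ A then (SignType.sign (φ (unit w j)) : ℝ) else 0 := by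
    simp only [x, map_sum, map_smul, Finset.sum_apply, Pi.smul_apply, toSeq_unit, smul_eq_mul,
      Pi.single_apply]
    simp
  have hφ : φ x = ∑ i ∈ A, |φ (unit w i)| := by
    simp only [x, map_sum, map_smul, smul_eq_mul, sign_mul_self]
  rw [← hφ, mul_comm]
  refine (le_abs_self _).trans ((φ.le_opNorm x).trans
    (mul_le_mul_of_nonneg_left (norm_le_partialSum (fun j => ?_) fun j hj => ?_) (norm_nonneg _)))
  · rw [hx]
    split_ifs
    · rcases SignType.sign (φ (unit w j)) with _ | _ | _ <;> simp
    · simp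
  · rw [hx, if_neg hj]

theorem sum_mul_abs_le_norm (x : LorentzSpace w) (τ : Equiv.Perm ℕ) (N : ℕ) :
    ∑ k ∈ Finset.range N, w.seq k * |toSeq w x (τ k)| ≤ ‖x‖ := by
  rw [norm_def, ← ENNReal.ofReal_le_iff_le_toReal (toSeq_ne_top x),
    ENNReal.ofReal_sum_of_nonneg fun k _ => mul_nonneg (w.pos k).le (abs_nonneg _)]
  exact (ENNReal.sum_le_tsum _).trans (le_iSup (fun σ : Equiv.Perm ℕ =>
    ∑' n, ENNReal.ofReal (w.seq n * |toSeq w x (σ n)|)) τ)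

/-- The duality inequality behind the norm formula. Once `|x|` is sorted, the hypothesis says that
the rearranged partial sums of `a` are dominated by those of `c • w`, and Abel summation applies. -/
theorem sum_mul_abs_le_mul_norm {a : ℕ → ℝ} {c : ℝ} (ha : ∀ i, 0 ≤ a i)
    (hc : ∀ A : Finset ℕ, ∑ i ∈ A, a i ≤ c * w.partialSum A.card) (x : LorentzSpace w)
    (S : Finset ℕ) : ∑ i ∈ S, a i * |toSeq w x i| ≤ c * ‖x‖ := by
  have hc0 : 0 ≤ c := by
    have h := (Finset.sum_nonneg fun i _ => ha i).trans (hc {0})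
    exact nonneg_of_mul_nonneg_left h (by simpa using w.partialSum_succ_pos 0)
  obtain ⟨N, hN⟩ := S.exists_nat_subset_range
  obtain ⟨τ, hτ, hanti⟩ := exists_perm_antitone_abs (toSeq w x) N
  calc ∑ i ∈ S, a i * |toSeq w x i|
      ≤ ∑ i ∈ Finset.range N, a i * |toSeq w x i| :=
        Finset.sum_le_sum_of_subset_of_nonneg hN fun i _ _ => mul_nonneg (ha i) (abs_nonneg _)
    _ = ∑ k ∈ Finset.range N, a (τ k) * |toSeq w x (τ k)| := by
        conv_lhs => rw [← hτ, Finset.sum_map]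
        rfl
    _ ≤ ∑ k ∈ Finset.range N, c * w.seq k * |toSeq w x (τ k)| := by
        refine sum_mul_le_sum_mul_of_antitone (fun k => abs_nonneg _) hanti fun n => ?_
        have h := hc ((Finset.range n).map τ.toEmbedding)
        rw [Finset.sum_map, Finset.card_map, Finset.card_range] at h
        rw [← Finset.mul_sum]
        exact h
    _ = c * ∑ k ∈ Finset.range N, w.seq k * |toSeq w x (τ k)| := by
        rw [Finset.mul_sum]
        exact Finset.sum_congr rfl fun k _ => mul_assoc _ _ _
    _ ≤ c * ‖x‖ := mul_le_mul_of_nonneg_left (sum_mul_abs_le_norm x τ N) hc0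

end LorentzSpace

/-! ### The predual -/

namespace LorentzPredual

open LorentzSpace

variable {w : LorentzWeight}

/-- The value of an element of the predual at the `i`-th unit vector. -/
def coeff (w : LorentzWeight) (i : ℕ) : StrongDual ℝ (lorentzPredual w) :=
  (ContinuousLinearMap.apply ℝ ℝ (unit w i)).comp (lorentzPredual w).subtypeL

theorem coeff_apply (i : ℕ) (φ : lorentzPredual w) : coeff w i φ = φ.1 (unit w i) := rfl

theorem coeff_sub (i : ℕ) (φ ψ : lorentzPredual w) :
    coeff w i (φ - ψ) = coeff w i φ - coeff w i ψ := rfl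

/-- The coordinate functionals as elements of the predual. -/
def basisVec (w : LorentzWeight) (i : ℕ) : lorentzPredual w :=
  ⟨coord w i, Submodule.le_topologicalClosure _ (Submodule.subset_span ⟨i, rfl⟩)⟩

theorem coeff_basisVec (i j : ℕ) :
    coeff w i (basisVec w j) = (Pi.single j (1 : ℝ) : ℕ → ℝ) i := by
  rw [coeff_apply]
  change coord w j (unit w i) = _
  rw [coord_unit, Pi.single_apply, Pi.single_apply]
  simp only [eq_comm]

theorem coeff_sum (F : Finset ℕ) (a : ℕ → ℝ) (j : ℕ) :
    coeff w j (∑ i ∈ F, a i • basisVec w i) = if j ∈ F then a j else 0 := by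
  simp only [map_sum, map_smul, coeff_basisVec, smul_eq_mul, Pi.single_apply]
  simp

theorem sum_abs_coeff_le (φ : lorentzPredual w) (A : Finset ℕ) :
    ∑ i ∈ A, |coeff w i φ| ≤ ‖φ‖ * w.partialSum A.card := by
  rw [mul_comm]
  exact sum_abs_apply_unit_le φ.1 A

theorem exists_sum_basisVec_near (φ : lorentzPredual w) {δ : ℝ} (hδ : 0 < δ) :
    ∃ (S : Finset ℕ) (a : ℕ → ℝ), ‖φ - ∑ i ∈ S, a i • basisVec w i‖ < δ := by
  obtain ⟨ψ, hψ, hd⟩ := Metric.mem_closure_iff.1 φ.2 δ hδ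
  obtain ⟨l, rfl⟩ := Finsupp.mem_span_range_iff_exists_finsupp.1 hψ
  refine ⟨l.support, l, ?_⟩
  rw [dist_eq_norm] at hd
  have hsum : (∑ i ∈ l.support, l i • basisVec w i : lorentzPredual w).1 =
      l.sum fun i a => a • coord w i :=
    map_sum (lorentzPredual w).subtype (fun i => l i • basisVec w i) l.support
  change ‖φ.1 - (∑ i ∈ l.support, l i • basisVec w i : lorentzPredual w).1‖ < δ
  rwa [hsum]

theorem norm_sum_basisVec_le {S : Finset ℕ} {a : ℕ → ℝ} {c : ℝ}
    (hc : ∀ A : Finset ℕ, ∑ i ∈ A, |coeff w i (∑ i ∈ S, a i • basisVec w i)| ≤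
      c * w.partialSum A.card) : ‖∑ i ∈ S, a i • basisVec w i‖ ≤ c := by
  set ψ := ∑ i ∈ S, a i • basisVec w i with hψ
  have hc0 : 0 ≤ c := by
    have h := (Finset.sum_nonneg fun i _ => abs_nonneg _).trans (hc {0})
    exact nonneg_of_mul_nonneg_left h (by simpa using w.partialSum_succ_pos 0)
  change ‖ψ.1‖ ≤ c
  refine ContinuousLinearMap.opNorm_le_bound _ hc0 fun x => ?_
  have h1 : ψ.1 x = ∑ i ∈ S, coeff w i ψ * toSeq w x i := by
    have h2 : ψ.1 x = ∑ i ∈ S, a i * toSeq w x i := by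
      simp [hψ, basisVec]
    rw [h2]
    refine Finset.sum_congr rfl fun i hi => ?_
    rw [hψ, coeff_sum, if_pos hi]
  rw [h1, Real.norm_eq_abs]
  refine (Finset.abs_sum_le_sum_abs _ _).trans ?_
  simp only [abs_mul]
  exact sum_mul_abs_le_mul_norm (fun i => abs_nonneg _) hc x S

/-- The average `W_|A|⁻¹ ∑_{i ∈ A} |φᵢ|`. -/
def avg (w : LorentzWeight) (A : Finset ℕ) : Seminorm ℝ (lorentzPredual w) :=
  Seminorm.of (fun φ => (∑ i ∈ A, |coeff w i φ|) / w.partialSum A.card)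
    (fun φ ψ => by
      rw [← add_div, ← Finset.sum_add_distrib]
      refine div_le_div_of_nonneg_right (Finset.sum_le_sum fun i _ => ?_) (w.partialSum_nonneg _)
      rw [map_add]
      exact abs_add_le _ _)
    (fun c φ => by
      simp only [map_smul, smul_eq_mul, abs_mul, ← Finset.mul_sum, Real.norm_eq_abs, mul_div_assoc])

theorem avg_apply (A : Finset ℕ) (φ : lorentzPredual w) :
    avg w A φ = (∑ i ∈ A, |coeff w i φ|) / w.partialSum A.card := rfl

/-- Cardinalities are written `n + 1` so that the denominator is positive; the empty set would give
`0 / 0`. -/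
theorem avg_le_iff {n : ℕ} {A : Finset ℕ} (hA : A.card = n + 1) (φ : lorentzPredual w) (c : ℝ) :
    avg w A φ ≤ c ↔ ∑ i ∈ A, |coeff w i φ| ≤ c * w.partialSum A.card := by
  rw [avg_apply, div_le_iff₀ (by rw [hA]; exact w.partialSum_succ_pos n)]

/-- The maximal average over sets of cardinality `n + 1`. -/
def maxAvg (w : LorentzWeight) (n : ℕ) : Seminorm ℝ (lorentzPredual w) :=
  ⨆ A : {A : Finset ℕ // A.card = n + 1}, avg w A

instance (n : ℕ) : Nonempty {A : Finset ℕ // A.card = n + 1} :=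
  ⟨⟨Finset.range (n + 1), Finset.card_range _⟩⟩

theorem bddAbove_avg (n : ℕ) (φ : lorentzPredual w) :
    BddAbove (Set.range fun A : {A : Finset ℕ // A.card = n + 1} => avg w A φ) :=
  ⟨‖φ‖, Set.forall_mem_range.2 fun A => (avg_le_iff A.2 φ _).2 (sum_abs_coeff_le φ A)⟩

theorem maxAvg_apply (n : ℕ) (φ : lorentzPredual w) :
    maxAvg w n φ = ⨆ A : {A : Finset ℕ // A.card = n + 1}, avg w A φ :=
  Seminorm.iSup_apply (Seminorm.bddAbove_range_iff.2 (bddAbove_avg n))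

theorem maxAvg_le_iff (n : ℕ) (φ : lorentzPredual w) (c : ℝ) :
    maxAvg w n φ ≤ c ↔
      ∀ A : Finset ℕ, A.card = n + 1 → ∑ i ∈ A, |coeff w i φ| ≤ c * w.partialSum A.card := by
  rw [maxAvg_apply, ciSup_le_iff (bddAbove_avg n φ)]
  exact ⟨fun h A hA => (avg_le_iff hA φ c).1 (h ⟨A, hA⟩),
    fun h A => (avg_le_iff A.2 φ c).2 (h A A.2)⟩

theorem maxAvg_le_norm (n : ℕ) (φ : lorentzPredual w) : maxAvg w n φ ≤ ‖φ‖ :=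
  (maxAvg_le_iff n φ _).2 fun A _ => sum_abs_coeff_le φ A

theorem maxAvg_mono {φ ψ : lorentzPredual w} (h : ∀ i, |coeff w i φ| ≤ |coeff w i ψ|) (n : ℕ) :
    maxAvg w n φ ≤ maxAvg w n ψ :=
  (maxAvg_le_iff n φ _).2 fun A hA =>
    (Finset.sum_le_sum fun i _ => h i).trans ((maxAvg_le_iff n ψ _).1 le_rfl A hA)

/-- For finitely supported elements this is the duality inequality; density extends it, as each
`maxAvg w n` is dominated by the norm. -/
theorem norm_le_of_maxAvg_le (φ : lorentzPredual w) (c : ℝ) (h : ∀ n, maxAvg w n φ ≤ c) :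
    ‖φ‖ ≤ c := by
  refine le_of_forall_pos_le_add fun δ hδ => ?_
  obtain ⟨S, a, hS⟩ := exists_sum_basisVec_near φ (half_pos hδ)
  set ψ := ∑ i ∈ S, a i • basisVec w i with hψ
  have h1 (n : ℕ) : maxAvg w n ψ ≤ c + δ / 2 := by
    have h2 : maxAvg w n ψ ≤ maxAvg w n φ + maxAvg w n (φ - ψ) :=
      le_map_add_map_sub' (maxAvg w n) ψ φ
    linarith [h n, maxAvg_le_norm n (φ - ψ)]
  have h3 : ‖ψ‖ ≤ c + δ / 2 := by
    refine norm_sum_basisVec_le fun A => ?_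
    rcases hA : A.card with _ | n
    · simp [Finset.card_eq_zero.1 hA, LorentzWeight.partialSum]
    · rw [← hA]
      exact (maxAvg_le_iff n ψ _).1 (h1 n) A hA
  have h4 := norm_le_norm_add_norm_sub' φ ψ
  linarith

theorem norm_mono {φ ψ : lorentzPredual w} (h : ∀ i, |coeff w i φ| ≤ |coeff w i ψ|) :
    ‖φ‖ ≤ ‖ψ‖ :=
  norm_le_of_maxAvg_le φ _ fun n => (maxAvg_mono h n).trans (maxAvg_le_norm n ψ)

theorem maxAvg_sum_basisVec_le (S : Finset ℕ) (a : ℕ → ℝ) (n : ℕ) :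
    maxAvg w n (∑ i ∈ S, a i • basisVec w i) ≤ (∑ i ∈ S, |a i|) / w.partialSum (n + 1) := by
  refine (maxAvg_le_iff n _ _).2 fun A hA => ?_
  rw [hA, div_mul_cancel₀ _ (w.partialSum_succ_pos n).ne']
  simp only [coeff_sum, apply_ite abs, abs_zero, ← Finset.sum_filter]
  refine Finset.sum_le_sum_of_subset_of_nonneg (fun i hi => (Finset.mem_filter.1 hi).2)
    fun i _ _ => abs_nonneg _

/-- Divergence of `∑ wₙ` enters here: on a finitely supported element the numerators are bounded
while `W (n + 1) → ∞`. Density does the rest. -/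
theorem tendsto_maxAvg (φ : lorentzPredual w) :
    Tendsto (fun n => maxAvg w n φ) atTop (𝓝 0) := by
  refine tendsto_order.2 ⟨fun c hc => Eventually.of_forall fun n =>
    hc.trans_le (apply_nonneg _ _), fun δ hδ => ?_⟩
  obtain ⟨S, a, hS⟩ := exists_sum_basisVec_near φ (half_pos hδ)
  have hlim : Tendsto (fun n => (∑ i ∈ S, |a i|) / w.partialSum (n + 1)) atTop (𝓝 0) :=
    (w.tendsto_partialSum.comp (tendsto_add_atTop_nat 1)).const_div_atTop _
  filter_upwards [hlim.eventually_lt_const (half_pos hδ)] with n hn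
  have h1 : maxAvg w n φ ≤ maxAvg w n (∑ i ∈ S, a i • basisVec w i) +
      maxAvg w n (φ - ∑ i ∈ S, a i • basisVec w i) := le_map_add_map_sub (maxAvg w n) φ _
  linarith [maxAvg_le_norm n (φ - ∑ i ∈ S, a i • basisVec w i),
    maxAvg_sum_basisVec_le (w := w) S a n]

theorem eq_of_coeff_eq {φ ψ : lorentzPredual w} (h : ∀ i, coeff w i φ = coeff w i ψ) : φ = ψ := by
  have h1 : ‖φ - ψ‖ ≤ ‖(0 : lorentzPredual w)‖ :=
    norm_mono fun i => by rw [coeff_sub, h i, sub_self, map_zero]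
  exact norm_sub_eq_zero_iff.1 (le_antisymm (h1.trans_eq (norm_zero (E := lorentzPredual w)))
    (norm_nonneg (φ - ψ)))

theorem hasSum_basisVec (φ : lorentzPredual w) :
    HasSum (fun i => coeff w i φ • basisVec w i) φ := by
  refine Metric.tendsto_atTop.2 fun δ hδ => ?_
  obtain ⟨S, a, hS⟩ := exists_sum_basisVec_near φ (half_pos hδ)
  refine ⟨S, fun F hF => ?_⟩
  set ψ := ∑ i ∈ S, a i • basisVec w i with hψ
  -- As `S ⊆ F`, the coefficients on the left are those of `φ - ψ` on `F` and zero elsewhere.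
  have h1 : ‖∑ i ∈ F, coeff w i φ • basisVec w i - ψ‖ ≤ ‖φ - ψ‖ := by
    refine norm_mono fun i => ?_
    rw [coeff_sub, coeff_sub, coeff_sum]
    split_ifs with hi
    · rfl
    · rw [hψ, coeff_sum, if_neg fun h => hi (hF h)]
      simp
  refine (dist_eq_norm (E := lorentzPredual w) _ _).trans_lt ?_
  have h2 : ‖∑ i ∈ F, coeff w i φ • basisVec w i - φ‖ ≤
      ‖∑ i ∈ F, coeff w i φ • basisVec w i - ψ‖ + ‖ψ - φ‖ :=
    norm_sub_le_norm_sub_add_norm_sub _ ψ φ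
  have h3 : ‖ψ - φ‖ = ‖φ - ψ‖ := norm_sub_rev ψ φ
  linarith

/-! ### The strictly convex perturbation -/

theorem abs_coeff_le (i : ℕ) (φ : lorentzPredual w) :
    |coeff w i φ| ≤ ‖φ‖ * w.partialSum 1 := by
  simpa using sum_abs_coeff_le φ {i}

theorem memℓp_geometric : Memℓp (fun i : ℕ => ((1 : ℝ) / 2) ^ i) 2 := by
  refine memℓp_gen ?_
  have h : Summable fun i : ℕ => ((1 : ℝ) / 4) ^ i :=
    summable_geometric_of_lt_one (by norm_num) (by norm_num)
  refine h.congr fun i => ?_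
  simp only [ENNReal.toReal_ofNat, Real.rpow_ofNat, norm_pow, ← pow_mul, mul_comm i 2]
  rw [pow_mul]
  norm_num

/-- The sequence `2⁻ⁱ` in `ℓ²`. -/
def geometric : lp (fun _ : ℕ => ℝ) 2 := ⟨_, memℓp_geometric⟩

theorem geometric_apply (i : ℕ) : geometric i = ((1 : ℝ) / 2) ^ i := rfl

theorem memℓp_coeff (φ : lorentzPredual w) :
    Memℓp (fun i : ℕ => ((1 : ℝ) / 2) ^ i * coeff w i φ) 2 := by
  refine (memℓp_geometric.const_mul (‖φ‖ * w.partialSum 1)).mono' fun i => ?_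
  rw [norm_mul, norm_mul, mul_comm,
    Real.norm_of_nonneg (mul_nonneg (norm_nonneg φ) (w.partialSum_nonneg 1))]
  exact mul_le_mul_of_nonneg_right (abs_coeff_le i φ) (norm_nonneg _)

/-- The weighted embedding `φ ↦ (2⁻ⁱ φᵢ)` into `ℓ²`. -/
def toL2 (w : LorentzWeight) : lorentzPredual w →ₗ[ℝ] lp (fun _ : ℕ => ℝ) 2 where
  toFun φ := ⟨_, memℓp_coeff φ⟩
  map_add' φ ψ := by
    ext i
    change (1 / 2) ^ i * coeff w i (φ + ψ) =
      (1 / 2) ^ i * coeff w i φ + (1 / 2) ^ i * coeff w i ψ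
    rw [map_add, mul_add]
  map_smul' c φ := by
    ext i
    simp [mul_left_comm]

theorem toL2_apply (φ : lorentzPredual w) (i : ℕ) :
    toL2 w φ i = ((1 : ℝ) / 2) ^ i * coeff w i φ := rfl

theorem toL2_injective : Function.Injective (toL2 w) := by
  intro φ ψ h
  refine eq_of_coeff_eq fun i => ?_
  have h1 : toL2 w φ i = toL2 w ψ i := by rw [h]
  rw [toL2_apply, toL2_apply] at h1
  exact mul_left_cancel₀ (by positivity) h1

/-- The bound uses the largest coefficient rather than `‖φ‖`, so it stays uniform on the vectors
`initialSum w n`, whose norms blow up. -/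
theorem norm_toL2_le (φ : lorentzPredual w) {c : ℝ} (hc : ∀ i, |coeff w i φ| ≤ c) :
    ‖toL2 w φ‖ ≤ c * ‖geometric‖ := by
  have hc0 : 0 ≤ c := (abs_nonneg _).trans (hc 0)
  rw [← Real.norm_of_nonneg hc0, ← norm_smul]
  refine lp.norm_mono two_ne_zero fun i => ?_
  rw [toL2_apply, lp.coeFn_smul, Pi.smul_apply, norm_mul, norm_smul, mul_comm, geometric_apply,
    Real.norm_of_nonneg hc0]
  exact mul_le_mul_of_nonneg_right (hc i) (norm_nonneg _)

theorem norm_toL2_mono {φ ψ : lorentzPredual w} (h : ∀ i, |coeff w i φ| ≤ |coeff w i ψ|) :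
    ‖toL2 w φ‖ ≤ ‖toL2 w ψ‖ := by
  refine lp.norm_mono two_ne_zero fun i => ?_
  rw [toL2_apply, toL2_apply, norm_mul, norm_mul]
  exact mul_le_mul_of_nonneg_left (h i) (norm_nonneg _)

/-- The norm of the predual as a supremum of maximal averages, perturbed by a weighted
`ℓ²` norm. -/
def presentation (w : LorentzWeight) : SupPresentation (lorentzPredual w) where
  p := maxAvg w
  q := (normSeminorm ℝ (lp (fun _ : ℕ => ℝ) 2)).comp (toL2 w)
  p_le := maxAvg_le_norm
  norm_le := norm_le_of_maxAvg_le
  tendsto_p := tendsto_maxAvg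
  q_le := ⟨w.partialSum 1 * ‖geometric‖, fun φ => by
    refine (norm_toL2_le φ fun i => abs_coeff_le i φ).trans_eq ?_
    ring⟩
  -- Equality in the triangle inequality of `ℓ²` puts the images on a common ray; injectivity of
  -- `toL2` pulls this back.
  sameRay φ ψ h := by
    simp only [Seminorm.comp_apply, coe_normSeminorm, map_add] at h
    exact (toL2_injective.sameRay_map_iff).1 (sameRay_iff_norm_add.2 h)

theorem seminorm_mono {φ ψ : lorentzPredual w} (h : ∀ i, |coeff w i φ| ≤ |coeff w i ψ|) :
    (presentation w).seminorm φ ≤ (presentation w).seminorm ψ :=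
  (presentation w).seminorm_mono (maxAvg_mono h) (norm_toL2_mono h)

/-! ### Flat vectors witnessing the local diameter two property -/

/-- The functional `x ↦ x₀ + ⋯ + xₙ`. -/
def initialSum (w : LorentzWeight) (n : ℕ) : lorentzPredual w :=
  ∑ i ∈ Finset.range (n + 1), (1 : ℝ) • basisVec w i

theorem abs_coeff_initialSum_le (n i : ℕ) : |coeff w i (initialSum w n)| ≤ 1 := by
  rw [initialSum, coeff_sum]
  split_ifs <;> simp

theorem tendsto_norm_initialSum : Tendsto (fun n => ‖initialSum w n‖) atTop atTop := by
  refine tendsto_atTop_mono (fun n => ?_) w.tendsto_div_partialSum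
  have h := sum_abs_coeff_le (initialSum w n) (Finset.range (n + 1))
  rw [Finset.card_range] at h
  rw [div_le_iff₀ (w.partialSum_succ_pos n)]
  refine le_trans (le_of_eq ?_) h
  rw [Finset.sum_congr rfl fun i hi => by rw [initialSum, coeff_sum, if_pos hi]]
  simp

theorem maxAvg_initialSum_le (m n : ℕ) :
    maxAvg w m (initialSum w n) ≤ ((m : ℝ) + 1) / w.partialSum (m + 1) := by
  refine (maxAvg_le_iff m _ _).2 fun A hA => ?_
  rw [hA, div_mul_cancel₀ _ (w.partialSum_succ_pos m).ne']
  refine (Finset.sum_le_sum fun i _ => abs_coeff_initialSum_le n i).trans_eq ?_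
  simp [hA]

theorem hasLD2P (w : LorentzWeight) : HasLD2P (presentation w).equivalentNorm.Space :=
  (presentation w).hasLD2P tendsto_norm_initialSum
    (fun m => ⟨_, maxAvg_initialSum_le m⟩)
    ⟨_, fun n => norm_toL2_le _ (abs_coeff_initialSum_le n)⟩

end LorentzPredual

/-! ### The unconditional basis of the renormed predual -/

namespace EquivalentNorm

variable {E : Type*} [NormedAddCommGroup E] [NormedSpace ℝ E] (N : EquivalentNorm E)

/-- The identity map from `E` to its renorming as a homeomorphism. -/
def toSpaceL : E ≃L[ℝ] N.Space where
  __ := N.toSpace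
  continuous_toFun := by
    obtain ⟨C, hC⟩ := N.le_mul_norm
    exact (N.toSpace.toLinearMap.mkContinuous C hC).continuous
  continuous_invFun := by
    obtain ⟨C, hC⟩ := N.norm_le_mul
    exact (N.toSpace.symm.toLinearMap.mkContinuous C hC).continuous

end EquivalentNorm

namespace LorentzPredual

/-- The coordinate functionals as an unconditional basis of the renormed predual. -/
def schauderBasis (w : LorentzWeight) :
    UnconditionalSchauderBasis ℕ ℝ (presentation w).equivalentNorm.Space where
  basis i := (presentation w).equivalentNorm.toSpaceL (basisVec w i)
  coord i := (coeff w i).comp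
    ((presentation w).equivalentNorm.toSpaceL.symm : _ →L[ℝ] lorentzPredual w)
  ortho i j := by
    refine (coeff_basisVec (w := w) i j).trans ?_
    congr!
  expansion x := by
    have h := (hasSum_basisVec ((presentation w).equivalentNorm.toSpaceL.symm x)).mapL
      ((presentation w).equivalentNorm.toSpaceL : lorentzPredual w →L[ℝ]
        (presentation w).equivalentNorm.Space)
    simpa using h

theorem isOneUnconditional_schauderBasis (w : LorentzWeight) :
    IsOneUnconditional (schauderBasis w) := by
  intro F a b hab
  change (presentation w).seminorm (∑ i ∈ F, b i • basisVec w i) ≤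
    (presentation w).seminorm (∑ i ∈ F, a i • basisVec w i)
  refine seminorm_mono fun j => ?_
  rw [coeff_sum, coeff_sum]
  split_ifs with hj
  · exact hab j hj
  · rfl

end LorentzPredual

end

theorem corollary5p6 (w : LorentzWeight) :
    ∃ N : EquivalentNorm (lorentzPredual w),
      StrictConvexSpace ℝ N.Space ∧
      (∃ e : UnconditionalSchauderBasis ℕ ℝ N.Space, IsOneUnconditional e) ∧
      HasLD2P N.Space :=
  ⟨(LorentzPredual.presentation w).equivalentNorm,
    (LorentzPredual.presentation w).strictConvexSpace,
    ⟨LorentzPredual.schauderBasis w, LorentzPredual.isOneUnconditional_schauderBasis w⟩,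
    LorentzPredual.hasLD2P w⟩
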